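/- There is an absolute constant $C>0$ such that the following holds. Let $p\ge 1$, let $\Sigma\in\mathbb R^{p\times p}$ be symmetric positive definite, let $x_1,\dots,x_n\sim N(0,\Sigma)$ be independent, let $X=[x_1,\dots,x_n]\in\mathbb R^{p\times n}$ and $\tilde X=\Sigma^{-1/2}X$. Let $0\le\alpha\le\beta<\frac1{65}$, $\delta\in(0,1)$ and $n\ge C\,(p+\log\frac1\delta)$. For a level $\gamma\in[0,1]$ and a subset $S\subseteq\{1,\dots,n\}$, let $\tilde X_S$ be the matrix of the columns of $\tilde X$ with index in $S$. Say that $\tilde X$ is subset strongly smooth at level $\gamma$ with constant $\Lambda_\gamma$ if $\lambda_{\max}(\tilde X_S\tilde X_S^\top)\le\Lambda_\gamma$ for all $S$ with $|S|=\lfloor\gamma n\rfloor$, and subset strongly convex at level $\gamma$ with constant $\lambda_\gamma$ if $\lambda_{\min}(\tilde X_S\tilde X_S^\top)\ge\lambda_\gamma$ for all such $S$. Then there is an event of probability at least $1-\delta$ on which both of the following hold. (1) $\tilde X$ is subset strongly smooth at level $\beta$ with a constant $\Lambda_\beta$ and subset strongly convex at level $1-\beta$ with a constant $\lambda_{1-\beta}>0$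 such that $$\frac{(1+\sqrt2)\,\Lambda_\beta}{\lambda_{1-\beta}}<\frac9{10}.$$ (2) Let $w^*\in\mathbb R^p$ and $b\in\mathbb R^n$ with $\|b\|_0\le\alpha n$ be arbitrary (they may depend on $X$), and let $y=X^\top w^*+b$. Consider TORRENT-FC with thresholding parameter $\beta$: start from $w^0=0$ and $S_0=\{1,\dots,n\}$, and at step $t$ let $w^{t+1}$ be any minimizer of $w\mapsto\sum_{i\in S_t}(y_i-\langle w,x_i\rangle)^2$ and let $S_{t+1}$ consist of the $\lfloor(1-\beta)n\rfloor$ indices with the smallest residuals $|y_i-\langle w^{t+1},x_i\rangle|$ (ties broken in any way); the algorithm stops, and keeps its state, once the residual norm $\big(\sum_{i\in S_t}(y_i-\langle w^t,x_i\rangle)^2\big)^{1/2}$ is at most a tolerance $\tau$. Let $\epsilon>0$ and $\tau\le\epsilon$ (a negative $\tau$ means that the algorithm never stops). Then for every integer $$T\ge\max\Big\{1,\;10\log\Big(\frac1{\sqrt n}\,\frac{\|b\|_2}{\epsilon}\Big)\Big\}$$ the state after $T$ iterations satisfies $$\|\Sigma^{1/2}(w^T-w^*)\|_2\le\epsilon,\qquad\text{hence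 also}\qquad\sqrt{\lambda_{\min}(\Sigma)}\;\|w^T-w^*\|_2\le\epsilon ;$$ in particular $\|w^T-w^*\|_2\le\epsilon$ whenever $\lambda_{\min}(\Sigma)\ge1$, for instance for $\Sigma=I$. (For $b=0$ the logarithm is read as $-\infty$.) -/

import Mathlib

open MeasureTheory ProbabilityTheory
open scoped MatrixOrder

noncomputable section

namespace Torrent

/-- The smallest eigenvalue of a real symmetric matrix (of positive size). -/
def lambdaMin {p : ℕ} (A : Matrix (Fin p) (Fin p) ℝ) : ℝ := sInf (spectrum ℝ A)

/-- The largest eigenvalue of a real symmetric matrix (of positive size). -/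
def lambdaMax {p : ℕ} (A : Matrix (Fin p) (Fin p) ℝ) : ℝ := sSup (spectrum ℝ A)

/-- The matrix whose columns are the data points. -/
def designMatrix {p n : ℕ} (x : Fin n → EuclideanSpace ℝ (Fin p)) : Matrix (Fin p) (Fin n) ℝ :=
  Matrix.of fun j i => x i j

/-- `X_S`: the columns of `X` with index in `S`. -/
def colSubmatrix {p n : ℕ} (X : Matrix (Fin p) (Fin n) ℝ) (S : Finset (Fin n)) :
    Matrix (Fin p) S ℝ :=
  X.submatrix id Subtype.val

/-- The index sets of size `γ n` (rounded down when `γ n` is not an integer). -/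
def subsetsOfLevel (n : ℕ) (γ : ℝ) : Set (Finset (Fin n)) :=
  {S | S.card = ⌊γ * (n : ℝ)⌋₊}

/-- Subset strong convexity at level `γ` with constant `lam`. -/
def SubsetStronglyConvex {p n : ℕ} (X : Matrix (Fin p) (Fin n) ℝ) (γ lam : ℝ) : Prop :=
  ∀ S ∈ subsetsOfLevel n γ, lam ≤ lambdaMin (colSubmatrix X S * (colSubmatrix X S).transpose)

/-- Subset strong smoothness at level `γ` with constant `Lam`. -/
def SubsetStronglySmooth {p n : ℕ} (X : Matrix (Fin p) (Fin n) ℝ) (γ Lam : ℝ) : Prop :=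
  ∀ S ∈ subsetsOfLevel n γ, lambdaMax (colSubmatrix X S * (colSubmatrix X S).transpose) ≤ Lam

/-- The residual vector `r = y - Xᵀ w`. -/
def residual {p n : ℕ} (x : Fin n → EuclideanSpace ℝ (Fin p)) (y : EuclideanSpace ℝ (Fin n))
    (w : EuclideanSpace ℝ (Fin p)) (i : Fin n) : ℝ :=
  y i - inner ℝ w (x i)

/-- The squared residual error of `w` on the index set `S`. -/
def sqError {p n : ℕ} (x : Fin n → EuclideanSpace ℝ (Fin p)) (y : EuclideanSpace ℝ (Fin n))
    (S : Finset (Fin n)) (w : EuclideanSpace ℝ (Fin p)) : ℝ :=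
  ∑ i ∈ S, residual x y w i ^ 2

/-- `S` is an output of the hard thresholding operator `HT(v; k)`: for a permutation `σ` that lists
the entries of `v` in ascending order of magnitude, `S` consists of the indices whose (one-based)
rank is at most `k`. Ties may be broken in any way. -/
def IsHardThreshold {n : ℕ} (v : Fin n → ℝ) (k : ℝ) (S : Finset (Fin n)) : Prop :=
  ∃ σ : Equiv.Perm (Fin n), (Monotone fun j => |v (σ j)|) ∧
    ∀ i, i ∈ S ↔ (((σ.symm i : ℕ) : ℝ) + 1) ≤ k

/-- `(w t, S t)`, `t = 0, 1, 2, …`, is a run of TORRENT-FC on the data `(x, y)` with thresholding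
parameter `β` and stopping tolerance `τ`: it starts from `w 0 = 0` and the full active set; as long
as the residual norm on the active set exceeds `τ`, it replaces `w` by a least squares solution on
the active set and then the active set by the `(1 - β) n` points with the smallest residuals; once
it has stopped, it keeps its state. Any choice among several least squares solutions or among tied
residuals is allowed. For `τ < 0` the stopping test is never passed. -/
structure IsRunFC {p n : ℕ} (x : Fin n → EuclideanSpace ℝ (Fin p)) (y : EuclideanSpace ℝ (Fin n))
    (β τ : ℝ) (w : ℕ → EuclideanSpace ℝ (Fin p)) (S : ℕ → Finset (Fin n)) : Prop where
  w_zero : w 0 = 0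
  S_zero : S 0 = Finset.univ
  step : ∀ t, τ < √(sqError x y (S t) (w t)) →
    (∀ v, sqError x y (S t) (w (t + 1)) ≤ sqError x y (S t) v) ∧
      IsHardThreshold (residual x y (w (t + 1))) ((1 - β) * (n : ℝ)) (S (t + 1))
  halt : ∀ t, √(sqError x y (S t) (w t)) ≤ τ → w (t + 1) = w t ∧ S (t + 1) = S t

end Torrent

end

/-! With g_i = Σ^{-1/2} x_i and u = Σ^{1/2}(w - w*), the residuals become b_i - ⟨u, g_i⟩, so it
suffices to study standard Gaussian data with target 0. Everything deterministic rests on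
`FrameBounds`: at most n/64 points carry energy ≤ 0.23 n‖u‖² in any direction u, and all points
together carry ≥ 0.85 n‖u‖². Hence the complement of such a small set carries ≥ 0.62 n‖u‖², and (1 +
√2)·23/62 < 9/10.

One iteration contracts the corruption left in the active set S. The normal equations and
Cauchy–Schwarz on the corrupted points of S give n‖u‖² ≤ (3/5) ∑_S b²
(`FrameBounds.norm_sq_le_of_isMin`). After thresholding, the corrupted points that are kept have
residuals dominated by those of equally many clean points, where the residual is just -⟨u, g_i⟩; so
the new ∑_S b² is at most 0.92 n‖u‖² (`FrameBounds.sum_sq_le_of_isHardThreshold`). The factor 0.92 ·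
3/5 = 0.552 lies below e^{-1/5}, which is what 10 log(·) iterations need. An early stop is harmless
because the residual norm on S bounds ‖u‖ (`FrameBounds.norm_sq_le_of_residual`).

The frame bounds hold with high probability by Chernoff bounds on a net of the sphere. No union over
subsets is needed: z² ≤ 12 + max(z² - 12, 0), and the excess summed over all points bounds the
excess over every subset at once. -/

namespace Torrent

/-! ### Gaussian exponential moments and tail bounds -/

theorem lintegral_exp_mul_sq_gaussianReal {s : ℝ} (hs : s < 1 / 2) :
    ∫⁻ z, ENNReal.ofReal (Real.exp (s * z ^ 2)) ∂gaussianReal 0 1 =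
      ENNReal.ofReal (√(1 - 2 * s))⁻¹ := by
  have hb : 0 < 1 / 2 - s := by linarith
  rw [gaussianReal_of_var_ne_zero 0 one_ne_zero,
    lintegral_withDensity_eq_lintegral_mul _ (measurable_gaussianPDF 0 1) (by fun_prop)]
  have h (z : ℝ) : (gaussianPDF 0 1 * fun z : ℝ => ENNReal.ofReal (Real.exp (s * z ^ 2))) z =
      ENNReal.ofReal ((√(2 * Real.pi))⁻¹ * Real.exp (-(1 / 2 - s) * z ^ 2)) := by
    rw [Pi.mul_apply, gaussianPDF, ← ENNReal.ofReal_mul (gaussianPDFReal_nonneg _ _ _),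
      gaussianPDFReal_def, mul_assoc, ← Real.exp_add]
    congr 2
    · simp
    · congr 1
      simp only [sub_zero, NNReal.coe_one]
      ring
  simp_rw [h]
  rw [← ofReal_integral_eq_lintegral_ofReal ((integrable_exp_neg_mul_sq hb).const_mul _)
    (Filter.Eventually.of_forall fun z => by positivity), integral_const_mul, integral_gaussian,
    ← Real.sqrt_inv, ← Real.sqrt_inv, ← Real.sqrt_mul (by positivity)]
  congr 2
  have h2 : (1 - 2 * s) ≠ 0 := by linarith
  have h3 : (1 / 2 - s) ≠ 0 := hb.ne'
  field_simp

/-- Chernoff's bound for functions of independent standard Gaussian variables. -/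
theorem measure_sum_comp_gaussian_ge_le {Ω : Type*} [MeasurableSpace Ω] {P : Measure Ω} {n : ℕ}
    {z : Fin n → Ω → ℝ} (hz : ∀ i, HasLaw (z i) (gaussianReal 0 1) P) (hind : iIndepFun z P)
    {f : ℝ → ℝ} (hf : Measurable f) {M : ℝ} (hM : 0 ≤ M)
    (hfM : ∫⁻ u, ENNReal.ofReal (Real.exp (f u)) ∂gaussianReal 0 1 ≤ ENNReal.ofReal M) (T : ℝ) :
    P {ω | T ≤ ∑ i, f (z i ω)} ≤ ENNReal.ofReal (Real.exp (-T) * M ^ n) := by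
  have hzm (i : Fin n) : AEMeasurable (z i) P := (hz i).aemeasurable
  let g : Fin n → Ω → ENNReal := fun i ω => ENNReal.ofReal (Real.exp (f (z i ω)))
  have hgm : Measurable fun u : ℝ => ENNReal.ofReal (Real.exp (f u)) := by fun_prop
  have hg (i : Fin n) : AEMeasurable (g i) P := hgm.comp_aemeasurable (hzm i)
  have hae : ∀ᵐ ω ∂P, ∀ i, g i ω = (hg i).mk (g i) ω :=
    ae_all_iff.2 fun i => (hg i).ae_eq_mk
  have hgind : iIndepFun g P :=
    hind.comp (fun _ u => ENNReal.ofReal (Real.exp (f u))) fun _ => hgm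
  -- The product formula is applied to measurable versions, since the laws only provide a.e.
  -- measurability.
  have hprod : ∫⁻ ω, ∏ i, g i ω ∂P = ∏ i, ∫⁻ ω, g i ω ∂P := by
    have h1 : ∫⁻ ω, ∏ i, g i ω ∂P = ∫⁻ ω, ∏ i, (hg i).mk (g i) ω ∂P :=
      lintegral_congr_ae (hae.mono fun ω hω => Finset.prod_congr rfl fun i _ => hω i)
    rw [h1, lintegral_prod_eq_prod_lintegral_of_indepFun _ _
      (hgind.congr fun i => (hg i).ae_eq_mk) fun i => (hg i).measurable_mk]
    exact Finset.prod_congr rfl fun i _ => lintegral_congr_ae (hg i).ae_eq_mk.symm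
  have hsub : {ω | T ≤ ∑ i, f (z i ω)} ⊆ {ω | ENNReal.ofReal (Real.exp T) ≤ ∏ i, g i ω} := by
    intro ω hω
    simp only [Set.mem_ofPred_eq, g] at hω ⊢
    rw [← ENNReal.ofReal_prod_of_nonneg fun _ _ => (Real.exp_pos _).le, ← Real.exp_sum]
    exact ENNReal.ofReal_le_ofReal (Real.exp_le_exp.2 hω)
  have h0 : ENNReal.ofReal (Real.exp T) ≠ 0 := by simp [Real.exp_pos]
  calc P {ω | T ≤ ∑ i, f (z i ω)} ≤ P {ω | ENNReal.ofReal (Real.exp T) ≤ ∏ i, g i ω} :=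
        measure_mono hsub
    _ ≤ (∫⁻ ω, ∏ i, g i ω ∂P) / ENNReal.ofReal (Real.exp T) :=
        meas_ge_le_lintegral_div (Finset.aemeasurable_fun_prod _ fun i _ => hg i) h0
          ENNReal.ofReal_ne_top
    _ ≤ ENNReal.ofReal (M ^ n) / ENNReal.ofReal (Real.exp T) := by
        gcongr
        rw [hprod, ENNReal.ofReal_pow hM]
        calc ∏ i, ∫⁻ ω, g i ω ∂P ≤ ∏ _i : Fin n, ENNReal.ofReal M := by
              refine Finset.prod_le_prod' fun i _ => ?_
              rw [← lintegral_map' (f := fun u => ENNReal.ofReal (Real.exp (f u)))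
                hgm.aemeasurable (hzm i), (hz i).map_eq]
              exact hfM
          _ = ENNReal.ofReal M ^ n := by simp
    _ = ENNReal.ofReal (Real.exp (-T) * M ^ n) := by
        rw [← ENNReal.ofReal_div_of_pos (Real.exp_pos _), Real.exp_neg]
        congr 1
        ring

/-- The part of a sum of squares of Gaussians that lies above a fixed level is small. -/
theorem measure_sum_truncated_sq_ge_le {Ω : Type*} [MeasurableSpace Ω] {P : Measure Ω} {n : ℕ}
    {z : Fin n → Ω → ℝ} (hz : ∀ i, HasLaw (z i) (gaussianReal 0 1) P) (hind : iIndepFun z P) :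
    P {ω | 1 / 25 * (n : ℝ) ≤ ∑ i, max (z i ω ^ 2 - 12) 0} ≤
      ENNReal.ofReal (Real.exp (-(n / 500))) := by
  -- The exponent s = 15/32 makes √(1 - 2s) = 1/4, so the moment is at most 1 + 4e^{-45/8} ≤ 1 +
  -- 1/64. The Chernoff rate is then 3/160 - 1/64 ≥ 1/500.
  have hm : ∫⁻ u, ENNReal.ofReal (Real.exp (15 / 32 * max (u ^ 2 - 12) 0)) ∂gaussianReal 0 1 ≤
      ENNReal.ofReal (Real.exp (1 / 64)) := by
    have hpt (u : ℝ) : ENNReal.ofReal (Real.exp (15 / 32 * max (u ^ 2 - 12) 0)) ≤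
        1 + ENNReal.ofReal (Real.exp (-(45 / 8))) *
          ENNReal.ofReal (Real.exp (15 / 32 * u ^ 2)) := by
      rw [← ENNReal.ofReal_mul (Real.exp_pos _).le, ← Real.exp_add, ← ENNReal.ofReal_one,
        ← ENNReal.ofReal_add zero_le_one (Real.exp_pos _).le]
      refine ENNReal.ofReal_le_ofReal ?_
      rcases max_cases (u ^ 2 - 12) 0 with ⟨h, -⟩ | ⟨h, -⟩ <;> rw [h]
      · rw [show 15 / 32 * (u ^ 2 - 12) = -(45 / 8) + 15 / 32 * u ^ 2 by ring]
        linarith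
      · simp [Real.exp_nonneg]
    calc _ ≤ ∫⁻ u, (1 + ENNReal.ofReal (Real.exp (-(45 / 8))) *
          ENNReal.ofReal (Real.exp (15 / 32 * u ^ 2))) ∂gaussianReal 0 1 := lintegral_mono hpt
      _ = 1 + ENNReal.ofReal (Real.exp (-(45 / 8))) * ENNReal.ofReal 4 := by
          rw [lintegral_add_left measurable_const, lintegral_const_mul _ (by fun_prop),
            lintegral_exp_mul_sq_gaussianReal (by norm_num)]
          have : √(1 - 2 * (15 / 32 : ℝ)) = 1 / 4 := by
            rw [show (1 - 2 * (15 / 32 : ℝ)) = (1 / 4) ^ 2 by norm_num]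
            exact Real.sqrt_sq (by norm_num)
          rw [this]
          norm_num
      _ ≤ ENNReal.ofReal (Real.exp (1 / 64)) := by
          rw [← ENNReal.ofReal_mul (Real.exp_pos _).le, ← ENNReal.ofReal_one,
            ← ENNReal.ofReal_add zero_le_one (by positivity)]
          refine ENNReal.ofReal_le_ofReal ?_
          have h1 : Real.exp (-(45 / 8)) ≤ 1 / 256 := by
            rw [Real.exp_neg, one_div]
            refine inv_anti₀ (by norm_num) ?_
            -- Eighth powers reduce 256 ≤ e^{45/8} to 2^64 ≤ e^45.
            have h2 : (2.7182818283 : ℝ) ^ 45 ≤ Real.exp (45 / 8) ^ 8 := by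
              rw [← Real.exp_nat_mul, show ((8 : ℕ) : ℝ) * (45 / 8) = (45 : ℕ) * 1 by norm_num,
                Real.exp_nat_mul]
              gcongr
              exact Real.exp_one_gt_d9.le
            refine le_of_pow_le_pow_left₀ (n := 8) (by norm_num) (Real.exp_pos _).le
              (le_trans ?_ h2)
            norm_num
          linarith [Real.add_one_le_exp (1 / 64 : ℝ)]
  have key := measure_sum_comp_gaussian_ge_le hz hind
    (f := fun u => 15 / 32 * max (u ^ 2 - 12) 0) (by fun_prop) (Real.exp_pos _).le hm (3 / 160 * n)
  simp_rw [← Finset.mul_sum] at key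
  have hset : {ω | 1 / 25 * (n : ℝ) ≤ ∑ i, max (z i ω ^ 2 - 12) 0} =
      {ω | 3 / 160 * (n : ℝ) ≤ 15 / 32 * ∑ i, max (z i ω ^ 2 - 12) 0} := by
    ext ω
    simp only [Set.mem_ofPred_eq]
    constructor <;> intro h <;> linarith
  rw [hset]
  refine key.trans (ENNReal.ofReal_le_ofReal ?_)
  rw [← Real.exp_nat_mul, ← Real.exp_add]
  refine Real.exp_le_exp.2 ?_
  have : (0 : ℝ) ≤ n := n.cast_nonneg
  linarith

/-- A sum of squares of independent standard Gaussians is not much smaller than its mean. -/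
theorem measure_sum_sq_le_le {Ω : Type*} [MeasurableSpace Ω] {P : Measure Ω} {n : ℕ}
    {z : Fin n → Ω → ℝ} (hz : ∀ i, HasLaw (z i) (gaussianReal 0 1) P) (hind : iIndepFun z P) :
    P {ω | ∑ i, z i ω ^ 2 ≤ 22 / 25 * (n : ℝ)} ≤ ENNReal.ofReal (Real.exp (-(n / 500))) := by
  -- The exponent -21/200 makes 1 - 2s = (11/10)². The rate 59/625 - 231/2500 is exactly 1/500.
  have hm : ∫⁻ u, ENNReal.ofReal (Real.exp (-(21 / 200) * u ^ 2)) ∂gaussianReal 0 1 ≤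
      ENNReal.ofReal (10 / 11) := by
    rw [lintegral_exp_mul_sq_gaussianReal (by norm_num)]
    have : √(1 - 2 * (-(21 / 200) : ℝ)) = 11 / 10 := by
      rw [show (1 - 2 * (-(21 / 200) : ℝ)) = (11 / 10) ^ 2 by norm_num]
      exact Real.sqrt_sq (by norm_num)
    rw [this]
    norm_num
  have key := measure_sum_comp_gaussian_ge_le hz hind
    (f := fun u => -(21 / 200) * u ^ 2) (by fun_prop) (by norm_num) hm (-(231 / 2500 * n))
  simp_rw [← Finset.mul_sum] at key
  have hset : {ω | ∑ i, z i ω ^ 2 ≤ 22 / 25 * (n : ℝ)} =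
      {ω | -(231 / 2500 * n : ℝ) ≤ -(21 / 200) * ∑ i, z i ω ^ 2} := by
    ext ω
    simp only [Set.mem_ofPred_eq]
    constructor <;> intro h <;> linarith
  rw [hset]
  refine key.trans (ENNReal.ofReal_le_ofReal ?_)
  have h1 : (10 / 11 : ℝ) ≤ Real.exp (-(59 / 625)) := by
    rw [Real.exp_neg, show (10 / 11 : ℝ) = (11 / 10)⁻¹ by norm_num]
    refine inv_anti₀ (Real.exp_pos _) ?_
    refine (Real.exp_bound' (n := 3) (by norm_num) (by norm_num) (by norm_num)).trans ?_
    norm_num [Finset.sum_range_succ, Nat.factorial]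
  calc Real.exp (- -(231 / 2500 * n)) * (10 / 11) ^ n
      ≤ Real.exp (- -(231 / 2500 * n)) * Real.exp (-(59 / 625)) ^ n := by gcongr
    _ = Real.exp (-(n / 500)) := by
        rw [← Real.exp_nat_mul, ← Real.exp_add]
        congr 1
        ring

/-! ### Nets of the sphere -/

/-- A volume bound for the size of an `ε`-separated subset of the unit ball. -/
theorem card_le_of_separated_unitBall {E : Type*} [NormedAddCommGroup E] [NormedSpace ℝ E]
    [FiniteDimensional ℝ E] {ε : ℝ} (hε : 0 < ε) (s : Finset E) (hs : ∀ c ∈ s, ‖c‖ ≤ 1)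
    (h : ∀ c ∈ s, ∀ d ∈ s, c ≠ d → ε ≤ ‖c - d‖) :
    (s.card : ℝ) ≤ (1 + 2 / ε) ^ Module.finrank ℝ E := by
  borelize E
  let μ : Measure E := Measure.addHaar
  have hε2 : 0 < ε / 2 := by positivity
  have hρ : 0 < 1 + ε / 2 := by positivity
  have hdisj : Set.PairwiseDisjoint (s : Set E) fun c => Metric.ball c (ε / 2) := by
    rintro c hc d hd hcd
    apply Metric.ball_disjoint_ball
    rw [dist_eq_norm]
    linarith [h c hc d hd hcd]
  have hsub : (⋃ c ∈ s, Metric.ball c (ε / 2)) ⊆ Metric.ball (0 : E) (1 + ε / 2) := by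
    refine Set.iUnion₂_subset fun c hc => Metric.ball_subset_ball' ?_
    rw [dist_zero_right]
    linarith [hs c hc]
  have hvol : (s.card : ENNReal) * ENNReal.ofReal ((ε / 2) ^ Module.finrank ℝ E) *
      μ (Metric.ball 0 1) ≤
      ENNReal.ofReal ((1 + ε / 2) ^ Module.finrank ℝ E) * μ (Metric.ball 0 1) := by
    rw [← μ.addHaar_ball_of_pos (0 : E) hρ]
    refine le_trans (le_of_eq ?_) (measure_mono hsub)
    rw [measure_biUnion_finset hdisj fun c _ => measurableSet_ball]
    simp [μ.addHaar_ball_of_pos _ hε2, mul_assoc]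
  have hJ := (ENNReal.mul_le_mul_iff_left (Metric.measure_ball_pos μ _ zero_lt_one).ne'
    measure_ball_lt_top.ne).1 hvol
  have hK : (s.card : ℝ) * (ε / 2) ^ Module.finrank ℝ E ≤
      (1 + ε / 2) ^ Module.finrank ℝ E := by
    simpa [hε2.le] using ENNReal.toReal_le_of_le_ofReal (by positivity) hJ
  rw [← le_div_iff₀ (by positivity), ← div_pow] at hK
  convert! hK using 2
  field_simp
  ring

/-- The unit sphere has `ε`-nets of size exponential in the dimension. -/
theorem exists_sphere_net (E : Type*) [NormedAddCommGroup E] [NormedSpace ℝ E]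
    [FiniteDimensional ℝ E] {ε : ℝ} (hε : 0 < ε) :
    ∃ N : Finset E, (∀ v ∈ N, ‖v‖ = 1) ∧ (∀ u : E, ‖u‖ = 1 → ∃ v ∈ N, ‖u - v‖ ≤ ε) ∧
      (N.card : ℝ) ≤ (1 + 2 / ε) ^ Module.finrank ℝ E := by
  let A : Set ℕ := {k | ∃ s : Finset E, (∀ v ∈ s, ‖v‖ = 1) ∧
    (∀ c ∈ s, ∀ d ∈ s, c ≠ d → ε ≤ ‖c - d‖) ∧ s.card = k}
  have hbdd : BddAbove A := by
    refine ⟨⌊(1 + 2 / ε) ^ Module.finrank ℝ E⌋₊, ?_⟩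
    rintro _ ⟨s, hs, hsep, rfl⟩
    exact Nat.le_floor (card_le_of_separated_unitBall hε s (fun c hc => (hs c hc).le) hsep)
  have hne : A.Nonempty := ⟨0, ∅, by simp⟩
  -- A separated set of maximal size is a net: a point far from all of it could be added.
  obtain ⟨N, hN, hsep, hcard⟩ := Nat.sSup_mem hne hbdd
  refine ⟨N, hN, fun u hu => ?_,
    card_le_of_separated_unitBall hε N (fun c hc => (hN c hc).le) hsep⟩
  by_contra! hfar
  have huN : u ∉ N := fun h => by
    have := hfar u h
    rw [sub_self, norm_zero] at this
    linarith
  have hmem : N.card + 1 ∈ A := by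
    refine ⟨N.cons u huN, ?_, ?_, Finset.card_cons huN⟩
    · intro v hv
      rcases Finset.mem_cons.1 hv with rfl | hv
      · exact hu
      · exact hN v hv
    · intro c hc d hd hcd
      rcases Finset.mem_cons.1 hc with rfl | hc' <;> rcases Finset.mem_cons.1 hd with rfl | hd'
      · exact absurd rfl hcd
      · exact (hfar d hd').le
      · rw [norm_sub_rev]
        exact (hfar c hc').le
      · exact hsep c hc' d hd' hcd
  have := le_csSup hbdd hmem
  omega

section Net

variable {E F : Type*} [NormedAddCommGroup E] [NormedSpace ℝ E] [NormedAddCommGroup F]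
  [NormedSpace ℝ F]

/-- The operator norm is controlled by the values on a net of the sphere. -/
theorem norm_apply_le_of_net {N : Set E} {ε m : ℝ} (hε : ε < 1) (hm : 0 ≤ m)
    (hN : ∀ u : E, ‖u‖ = 1 → ∃ v ∈ N, ‖u - v‖ ≤ ε) (L : E →L[ℝ] F)
    (hL : ∀ v ∈ N, ‖L v‖ ≤ m) (u : E) : ‖L u‖ ≤ m / (1 - ε) * ‖u‖ := by
  have h1 : ‖L‖ ≤ m + ‖L‖ * ε := by
    by_cases hε0 : 0 ≤ ε
    · refine L.opNorm_le_of_unit_norm (by positivity) fun u hu => ?_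
      obtain ⟨v, hv, huv⟩ := hN u hu
      calc ‖L u‖ = ‖L v + L (u - v)‖ := by rw [← map_add, add_sub_cancel]
        _ ≤ ‖L v‖ + ‖L (u - v)‖ := norm_add_le _ _
        _ ≤ m + ‖L‖ * ε :=
          add_le_add (hL v hv) ((L.le_opNorm _).trans (by gcongr))
    -- For ε < 0 the net condition excludes unit vectors, so the space is trivial.
    · have : L = 0 := by
        ext u
        by_contra h
        have hu : u ≠ 0 := fun h0 => h (by simp [h0])
        obtain ⟨v, -, hv⟩ := hN (‖u‖⁻¹ • u) (norm_smul_inv_norm hu)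
        exact hε0 ((norm_nonneg _).trans hv)
      simp [this, hm]
  have h2 : ‖L‖ ≤ m / (1 - ε) := by
    rw [le_div_iff₀ (by linarith)]
    linarith
  exact (L.le_opNorm u).trans (by gcongr)

/-- A lower bound on a net of the sphere extends to the whole space. -/
theorem le_norm_apply_of_net {N : Set E} {ε m M : ℝ}
    (hN : ∀ u : E, ‖u‖ = 1 → ∃ v ∈ N, ‖u - v‖ ≤ ε) (L : E →L[ℝ] F)
    (hL : ∀ v ∈ N, m ≤ ‖L v‖) (hM : 0 ≤ M) (hLM : ∀ u, ‖L u‖ ≤ M * ‖u‖) (u : E) :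
    (m - M * ε) * ‖u‖ ≤ ‖L u‖ := by
  rcases eq_or_ne u 0 with rfl | hu
  · simp
  obtain ⟨v, hv, huv⟩ := hN (‖u‖⁻¹ • u) (norm_smul_inv_norm hu)
  have h1 : ‖L v‖ ≤ ‖L (‖u‖⁻¹ • u)‖ + ‖L (‖u‖⁻¹ • u - v)‖ := by
    rw [map_sub]
    exact norm_le_norm_add_norm_sub _ _
  have h2 : ‖L (‖u‖⁻¹ • u - v)‖ ≤ M * ε := (hLM _).trans (by gcongr)
  have h3 : ‖L (‖u‖⁻¹ • u)‖ = ‖L u‖ / ‖u‖ := by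
    rw [map_smul, norm_smul, norm_inv, norm_norm]
    field_simp
  rw [← le_div_iff₀ (norm_pos_iff.2 hu), ← h3]
  linarith [hL v hv]

end Net

/-! ### Frame bounds -/

/-- The coordinates of a linear form family on an index set, as a bounded operator. -/
noncomputable def analysisCLM {p n : ℕ} (g : Fin n → EuclideanSpace ℝ (Fin p)) (S : Finset (Fin n)) :
    EuclideanSpace ℝ (Fin p) →L[ℝ] EuclideanSpace ℝ S :=
  LinearMap.toContinuousLinearMap
    { toFun := fun u => WithLp.toLp 2 fun i : S => inner ℝ u (g i)
      map_add' := fun u v => by ext i; simp [inner_add_left]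
      map_smul' := fun c u => by ext i; simp [real_inner_smul_left] }

theorem norm_sq_analysisCLM {p n : ℕ} (g : Fin n → EuclideanSpace ℝ (Fin p))
    (S : Finset (Fin n)) (u : EuclideanSpace ℝ (Fin p)) :
    ‖analysisCLM g S u‖ ^ 2 = ∑ i ∈ S, inner ℝ u (g i) ^ 2 := by
  rw [EuclideanSpace.real_norm_sq_eq, ← Finset.sum_coe_sort S]
  rfl

/-- The frame bounds that drive the convergence analysis: small sets of points carry little energy
in any direction, and all points together carry almost the expected energy. -/
structure FrameBounds {p n : ℕ} (g : Fin n → EuclideanSpace ℝ (Fin p)) : Prop where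
  upper : ∀ S : Finset (Fin n), 64 * (S.card : ℝ) ≤ n → ∀ u,
    ∑ i ∈ S, inner ℝ u (g i) ^ 2 ≤ 23 / 100 * n * ‖u‖ ^ 2
  lower : ∀ u, 85 / 100 * n * ‖u‖ ^ 2 ≤ ∑ i, inner ℝ u (g i) ^ 2

/-- Truncation at 12 bounds the energy of S on the net by 12|S| + n/25, for all S simultaneously.
For |S| ≤ n/64 this is 0.2275 n, which leaves room for the net loss 1/0.999². -/
theorem FrameBounds.of_net {p n : ℕ} {g : Fin n → EuclideanSpace ℝ (Fin p)}
    {N : Set (EuclideanSpace ℝ (Fin p))}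
    (hN : ∀ u : EuclideanSpace ℝ (Fin p), ‖u‖ = 1 → ∃ v ∈ N, ‖u - v‖ ≤ 1 / 1000)
    (htrunc : ∀ v ∈ N, ∑ i, max (inner ℝ v (g i) ^ 2 - 12) 0 ≤ 1 / 25 * (n : ℝ))
    (hlow : ∀ v ∈ N, 22 / 25 * (n : ℝ) ≤ ∑ i, inner ℝ v (g i) ^ 2) : FrameBounds g := by
  have hup : ∀ S : Finset (Fin n), ∀ u,
      ∑ i ∈ S, inner ℝ u (g i) ^ 2 ≤
        (12 * (S.card : ℝ) + 1 / 25 * n) / (999 / 1000) ^ 2 * ‖u‖ ^ 2 := by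
    intro S u
    have h := norm_apply_le_of_net (m := √(12 * (S.card : ℝ) + 1 / 25 * n)) (by norm_num)
      (Real.sqrt_nonneg _) hN (analysisCLM g S) (fun v hv => by
        rw [← abs_of_nonneg (norm_nonneg (analysisCLM g S v))]
        refine Real.abs_le_sqrt ?_
        rw [norm_sq_analysisCLM]
        calc ∑ i ∈ S, inner ℝ v (g i) ^ 2
            ≤ ∑ i ∈ S, (12 + max (inner ℝ v (g i) ^ 2 - 12) 0) :=
              Finset.sum_le_sum fun i _ => by
                linarith [le_max_left ((inner ℝ v (g i) : ℝ) ^ 2 - 12) 0]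
          _ = 12 * (S.card : ℝ) + ∑ i ∈ S, max ((inner ℝ v (g i) : ℝ) ^ 2 - 12) 0 := by
              rw [Finset.sum_add_distrib, Finset.sum_const, nsmul_eq_mul, mul_comm]
          _ ≤ 12 * (S.card : ℝ) + ∑ i, max ((inner ℝ v (g i) : ℝ) ^ 2 - 12) 0 := by
              gcongr
              exact Finset.subset_univ S
          _ ≤ 12 * (S.card : ℝ) + 1 / 25 * n := by
              gcongr
              exact htrunc v hv) u
    have h2 := pow_le_pow_left₀ (norm_nonneg _) h 2
    rw [norm_sq_analysisCLM, mul_pow, div_pow, Real.sq_sqrt (by positivity)] at h2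
    convert! h2 using 4
    norm_num
  have hn : (0 : ℝ) ≤ n := n.cast_nonneg
  refine ⟨fun S hS u => (hup S u).trans ?_, fun u => ?_⟩
  · gcongr
    rw [div_le_iff₀ (by norm_num)]
    linarith
  -- The same bound with S everything gives the crude operator norm 3.5√n. A net of mesh 1/1000 then
  -- lowers √0.88 ≥ 0.938 only to 0.9345, whose square exceeds 0.85.
  · have hM : ∀ u, ‖analysisCLM g Finset.univ u‖ ≤ 7 / 2 * √n * ‖u‖ := by
      intro u
      refine le_of_sq_le_sq ?_ (by positivity)
      rw [norm_sq_analysisCLM, mul_pow, mul_pow, Real.sq_sqrt hn]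
      refine (hup _ u).trans ?_
      rw [Finset.card_univ, Fintype.card_fin]
      gcongr
      rw [div_le_iff₀ (by norm_num)]
      linarith
    have hm : ∀ v ∈ N, 938 / 1000 * √n ≤ ‖analysisCLM g Finset.univ v‖ := by
      intro v hv
      refine le_of_sq_le_sq ?_ (norm_nonneg _)
      rw [norm_sq_analysisCLM, mul_pow, Real.sq_sqrt hn]
      refine le_trans ?_ (hlow v hv)
      gcongr
      norm_num
    have h := le_norm_apply_of_net hN (analysisCLM g Finset.univ) hm (by positivity) hM u
    rw [← norm_sq_analysisCLM]
    refine le_trans ?_ (pow_le_pow_left₀ (mul_nonneg ?_ (norm_nonneg _)) h 2)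
    · rw [mul_pow, show 938 / 1000 * √n - 7 / 2 * √n * (1 / 1000) = 9345 / 10000 * √n by ring,
        mul_pow, Real.sq_sqrt hn]
      gcongr
      norm_num
    · linarith [Real.sqrt_nonneg (n : ℝ)]

/-! ### Hard thresholding -/

theorem IsHardThreshold.abs_le {n : ℕ} {v : Fin n → ℝ} {k : ℝ} {S : Finset (Fin n)}
    (h : IsHardThreshold v k S) {i j : Fin n} (hi : i ∈ S) (hj : j ∉ S) : |v i| ≤ |v j| := by
  obtain ⟨σ, hσ, hS⟩ := h
  have h1 := (hS i).1 hi
  have h2 : k < ((σ.symm j : ℕ) : ℝ) + 1 := by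
    by_contra! h
    exact hj ((hS j).2 h)
  have h3 : (σ.symm i : ℕ) < (σ.symm j : ℕ) := by
    have : ((σ.symm i : ℕ) : ℝ) < ((σ.symm j : ℕ) : ℝ) := by linarith
    exact_mod_cast this
  simpa using hσ (show σ.symm i ≤ σ.symm j from h3.le)

theorem IsHardThreshold.card_eq {n : ℕ} {v : Fin n → ℝ} {k : ℝ} {S : Finset (Fin n)}
    (h : IsHardThreshold v k S) (hk : 0 ≤ k) (hkn : k ≤ n) : S.card = ⌊k⌋₊ := by
  obtain ⟨σ, -, hS⟩ := h
  have hle : ⌊k⌋₊ ≤ n := Nat.floor_le_of_le hkn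
  have : S = (Finset.univ.filter fun r : Fin n => (r : ℕ) < ⌊k⌋₊).map σ.toEmbedding := by
    ext i
    rw [hS, Finset.mem_map_equiv, Finset.mem_filter, ← Nat.add_one_le_iff, Nat.le_floor_iff hk]
    simp
  rw [this, Finset.card_map, Fin.card_filter_val_lt, min_eq_right hle]

/-- The indices that hard thresholding wrongly keeps have residuals dominated by the residuals of
equally many uncorrupted indices. -/
theorem IsHardThreshold.exists_dominating {n : ℕ} {v : Fin n → ℝ} {k : ℝ} {S B : Finset (Fin n)}
    (h : IsHardThreshold v k S) (hcard : S.card + B.card ≤ n) :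
    ∃ R : Finset (Fin n), Disjoint R B ∧ R.card = (S ∩ B).card ∧
      ∑ i ∈ S ∩ B, v i ^ 2 ≤ ∑ i ∈ R, v i ^ 2 := by
  -- There are enough clean discarded indices to match S ∩ B, as |S ∪ B| = |S| + |B| - |S ∩ B| and
  -- |S| + |B| ≤ n.
  have h1 : (S ∩ B).card ≤ ((S ∪ B)ᶜ).card := by
    have := Finset.card_union_add_card_inter S B
    rw [Finset.card_compl, Fintype.card_fin]
    omega
  obtain ⟨R, hR, hRc⟩ := Finset.exists_subset_card_eq h1
  have hR' : ∀ i ∈ R, i ∉ S ∧ i ∉ B := fun i hi => by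
    simpa using hR hi
  refine ⟨R, Finset.disjoint_left.2 fun i hi => (hR' i hi).2, hRc, ?_⟩
  let e := Finset.equivOfCardEq hRc.symm
  rw [← Finset.sum_coe_sort (S ∩ B), ← Finset.sum_coe_sort R, ← Equiv.sum_comp e]
  refine Finset.sum_le_sum fun i _ => sq_le_sq.2 ?_
  exact h.abs_le (Finset.mem_inter.1 i.2).1 (hR' _ (e i).2).1

/-! ### One iteration under the frame bounds -/

section FrameBounds

variable {p n : ℕ} {g : Fin n → EuclideanSpace ℝ (Fin p)}

theorem FrameBounds.lower_of_compl (hg : FrameBounds g) {S : Finset (Fin n)}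
    (hS : 64 * (Sᶜ.card : ℝ) ≤ n) (u : EuclideanSpace ℝ (Fin p)) :
    62 / 100 * n * ‖u‖ ^ 2 ≤ ∑ i ∈ S, inner ℝ u (g i) ^ 2 := by
  have h1 := hg.lower u
  have h2 := hg.upper Sᶜ hS u
  rw [← Finset.sum_add_sum_compl S] at h1
  linarith

/-- The error of a least squares fit is controlled by the corruption left in the active set. -/
theorem FrameBounds.norm_sq_le_of_isMin (hg : FrameBounds g) (hn : 0 < n) {b : Fin n → ℝ}
    {S B : Finset (Fin n)} (hS : 64 * (Sᶜ.card : ℝ) ≤ n) (hB : 64 * (B.card : ℝ) ≤ n)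
    (hb : ∀ i ∉ B, b i = 0) {u : EuclideanSpace ℝ (Fin p)}
    (hmin : ∀ v : EuclideanSpace ℝ (Fin p),
      ∑ i ∈ S, (b i - inner ℝ u (g i)) ^ 2 ≤ ∑ i ∈ S, (b i - inner ℝ v (g i)) ^ 2) :
    n * ‖u‖ ^ 2 ≤ 3 / 5 * ∑ i ∈ S, b i ^ 2 := by
  -- Only the normal equation in the direction u itself is needed, so minimality is tested along u +
  -- s • u. In the choice s = Y / (Z + 1), the + 1 covers Z = 0.
  have hortho : ∑ i ∈ S, (b i - inner ℝ u (g i)) * inner ℝ u (g i) = 0 := by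
    set Z := ∑ i ∈ S, inner ℝ u (g i) ^ 2 with hZ
    set Y := ∑ i ∈ S, (b i - inner ℝ u (g i)) * inner ℝ u (g i) with hY
    have hZ0 : 0 ≤ Z := Finset.sum_nonneg fun i _ => sq_nonneg _
    have hquad : ∀ s : ℝ, 0 ≤ s ^ 2 * Z - 2 * s * Y := by
      intro s
      have h := hmin (u + s • u)
      have heq : ∑ i ∈ S, (b i - inner ℝ (u + s • u) (g i)) ^ 2 =
          ∑ i ∈ S, (b i - inner ℝ u (g i)) ^ 2 + (s ^ 2 * Z - 2 * s * Y) := by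
        rw [hZ, hY, Finset.mul_sum, Finset.mul_sum, ← Finset.sum_sub_distrib,
          ← Finset.sum_add_distrib]
        refine Finset.sum_congr rfl fun i _ => ?_
        rw [inner_add_left, real_inner_smul_left]
        ring
      linarith
    have h := hquad (Y / (Z + 1))
    have h2 : (Y / (Z + 1)) ^ 2 * Z - 2 * (Y / (Z + 1)) * Y =
        -(Y ^ 2 * (Z + 2) / (Z + 1) ^ 2) := by
      field_simp
      ring
    rw [h2, neg_nonneg] at h
    by_contra hne
    have : 0 < Y ^ 2 * (Z + 2) / (Z + 1) ^ 2 := by positivity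
    linarith
  have hsum : ∑ i ∈ S, inner ℝ u (g i) ^ 2 = ∑ i ∈ S ∩ B, b i * inner ℝ u (g i) := by
    have h1 : ∑ i ∈ S ∩ B, b i * inner ℝ u (g i) = ∑ i ∈ S, b i * inner ℝ u (g i) := by
      refine Finset.sum_subset Finset.inter_subset_left fun i hi hi' => ?_
      rw [hb i fun h => hi' (Finset.mem_inter.2 ⟨hi, h⟩), zero_mul]
    rw [h1, ← sub_eq_zero, ← neg_eq_zero, ← hortho, ← Finset.sum_sub_distrib,
      ← Finset.sum_neg_distrib]
    exact Finset.sum_congr rfl fun i _ => by ring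
  have hcs := Finset.sum_mul_sq_le_sq_mul_sq (S ∩ B) b fun i => inner ℝ u (g i)
  rw [← hsum] at hcs
  have hlow := hg.lower_of_compl hS u
  have hup := hg.upper (S ∩ B) ((mul_le_mul_of_nonneg_left (by
    exact_mod_cast Finset.card_le_card Finset.inter_subset_right) (by norm_num)).trans hB) u
  have hbS : ∑ i ∈ S ∩ B, b i ^ 2 ≤ ∑ i ∈ S, b i ^ 2 :=
    Finset.sum_le_sum_of_subset_of_nonneg Finset.inter_subset_left fun _ _ _ => sq_nonneg _
  have hn' : (0 : ℝ) < n := by exact_mod_cast hn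
  have hb0 : 0 ≤ ∑ i ∈ S, b i ^ 2 := Finset.sum_nonneg fun _ _ => sq_nonneg _
  rcases eq_or_ne u 0 with rfl | hu
  · simpa using hb0
  have hu2 : 0 < ‖u‖ ^ 2 := by positivity
  have h3 : (62 / 100 * n * ‖u‖ ^ 2) ^ 2 ≤
      (∑ i ∈ S, b i ^ 2) * (23 / 100 * n * ‖u‖ ^ 2) := by
    refine (pow_le_pow_left₀ (by positivity) hlow 2).trans (hcs.trans ?_)
    exact mul_le_mul hbS hup (Finset.sum_nonneg fun _ _ => sq_nonneg _) hb0
  -- One factor n‖u‖² cancels; 0.23 / 0.62² < 3/5.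
  have h4 : (62 / 100) ^ 2 * (n * ‖u‖ ^ 2) ≤ 23 / 100 * ∑ i ∈ S, b i ^ 2 := by
    refine le_of_mul_le_mul_right ?_ (mul_pos hn' hu2)
    linarith
  linarith

/-- One round of hard thresholding leaves little corruption in the active set. -/
theorem FrameBounds.sum_sq_le_of_isHardThreshold (hg : FrameBounds g) {b : Fin n → ℝ} {k : ℝ}
    {S B : Finset (Fin n)} (hB : 64 * (B.card : ℝ) ≤ n) (hb : ∀ i ∉ B, b i = 0)
    {u : EuclideanSpace ℝ (Fin p)}
    (hS : IsHardThreshold (fun i => b i - inner ℝ u (g i)) k S) (hcard : S.card + B.card ≤ n) :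
    ∑ i ∈ S, b i ^ 2 ≤ 92 / 100 * (n * ‖u‖ ^ 2) := by
  obtain ⟨R, hRB, hRc, hR⟩ := hS.exists_dominating hcard
  have hDB : 64 * ((S ∩ B).card : ℝ) ≤ n := (mul_le_mul_of_nonneg_left (by
    exact_mod_cast Finset.card_le_card Finset.inter_subset_right) (by norm_num)).trans hB
  have h1 := hg.upper (S ∩ B) hDB u
  have h2 := hg.upper R (hRc ▸ hDB) u
  have h3 : ∑ i ∈ R, (b i - inner ℝ u (g i)) ^ 2 = ∑ i ∈ R, inner ℝ u (g i) ^ 2 :=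
    Finset.sum_congr rfl fun i hi => by
      rw [hb i (Finset.disjoint_left.1 hRB hi)]
      ring
  have h4 : ∑ i ∈ S ∩ B, b i ^ 2 = ∑ i ∈ S, b i ^ 2 :=
    Finset.sum_subset Finset.inter_subset_left fun i hi hi' => by
      rw [hb i fun h => hi' (Finset.mem_inter.2 ⟨hi, h⟩), zero_pow two_ne_zero]
  have h5 : ∑ i ∈ S ∩ B, b i ^ 2 ≤ 2 * ∑ i ∈ S ∩ B, (b i - inner ℝ u (g i)) ^ 2 +
      2 * ∑ i ∈ S ∩ B, inner ℝ u (g i) ^ 2 := by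
    rw [Finset.mul_sum, Finset.mul_sum, ← Finset.sum_add_distrib]
    refine Finset.sum_le_sum fun i _ => ?_
    linarith [sq_nonneg (b i - inner ℝ u (g i) - inner ℝ u (g i))]
  linarith

/-- A small residual on the active set certifies a small error. -/
theorem FrameBounds.norm_sq_le_of_residual (hg : FrameBounds g) (hn : 3 ≤ n) {b : Fin n → ℝ}
    {S B : Finset (Fin n)} (hS : 64 * (Sᶜ.card : ℝ) ≤ n) (hB : 64 * (B.card : ℝ) ≤ n)
    (hb : ∀ i ∉ B, b i = 0) (u : EuclideanSpace ℝ (Fin p)) :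
    ‖u‖ ^ 2 ≤ ∑ i ∈ S, (b i - inner ℝ u (g i)) ^ 2 := by
  have h1 := hg.lower_of_compl hS u
  have h2 := hg.upper B hB u
  have h3 : ∑ i ∈ S, inner ℝ u (g i) ^ 2 ≤
      ∑ i ∈ S \ B, inner ℝ u (g i) ^ 2 + ∑ i ∈ B, inner ℝ u (g i) ^ 2 := by
    rw [← Finset.sum_union Finset.sdiff_disjoint]
    refine Finset.sum_le_sum_of_subset_of_nonneg ?_ fun _ _ _ => sq_nonneg _
    rw [Finset.sdiff_union_self_eq_union]
    exact Finset.subset_union_left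
  have h4 : ∑ i ∈ S \ B, inner ℝ u (g i) ^ 2 = ∑ i ∈ S \ B, (b i - inner ℝ u (g i)) ^ 2 :=
    Finset.sum_congr rfl fun i hi => by
      rw [hb i (Finset.mem_sdiff.1 hi).2]
      ring
  have h5 : ∑ i ∈ S \ B, (b i - inner ℝ u (g i)) ^ 2 ≤ ∑ i ∈ S, (b i - inner ℝ u (g i)) ^ 2 :=
    Finset.sum_le_sum_of_subset_of_nonneg Finset.sdiff_subset fun _ _ _ => sq_nonneg _
  have hn' : (3 : ℝ) ≤ n := by exact_mod_cast hn
  -- The clean points of S carry at least (0.62 - 0.23) n‖u‖², and 0.39 n ≥ 1 once n ≥ 3.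
  nlinarith [mul_le_mul_of_nonneg_right hn' (sq_nonneg ‖u‖)]

end FrameBounds

/-! ### Convergence of the iteration -/

/-- The two possible states of TORRENT-FC after `t` steps: either the error is already below the
target, or the corruption in the active set has decreased geometrically. -/
theorem FrameBounds.norm_le_of_run {p n : ℕ} {g : Fin n → EuclideanSpace ℝ (Fin p)}
    (hg : FrameBounds g) (hn : 3 ≤ n) {β : ℝ} (hβ1 : β ≤ 1)
    (hβ : 64 * (β * n + 1) ≤ n) {b : EuclideanSpace ℝ (Fin n)}
    (hb : ((Finset.univ.filter fun i => b i ≠ 0).card : ℝ) ≤ β * n) {ε τ : ℝ} (hε : 0 < ε)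
    (hτ : τ ≤ ε) {u : ℕ → EuclideanSpace ℝ (Fin p)} {S : ℕ → Finset (Fin n)}
    (hS0 : S 0 = Finset.univ)
    (hstep : ∀ t, τ < √(∑ i ∈ S t, (b i - inner ℝ (u t) (g i)) ^ 2) →
      (∀ v : EuclideanSpace ℝ (Fin p), ∑ i ∈ S t, (b i - inner ℝ (u (t + 1)) (g i)) ^ 2 ≤
        ∑ i ∈ S t, (b i - inner ℝ v (g i)) ^ 2) ∧
      IsHardThreshold (fun i => b i - inner ℝ (u (t + 1)) (g i)) ((1 - β) * n) (S (t + 1)))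
    (hhalt : ∀ t, √(∑ i ∈ S t, (b i - inner ℝ (u t) (g i)) ^ 2) ≤ τ →
      u (t + 1) = u t ∧ S (t + 1) = S t)
    {T : ℕ} (hT : 1 ≤ T) (hTlog : 10 * Real.log (1 / √(n : ℝ) * (‖b‖ / ε)) ≤ T) :
    ‖u T‖ ≤ ε := by
  set B := Finset.univ.filter fun i => b i ≠ 0 with hBdef
  have hbB : ∀ i ∉ B, b i = 0 := fun i hi => by simpa [hBdef] using hi
  have hn0 : 0 < n := by omega
  have hn' : (0 : ℝ) < n := by exact_mod_cast hn0
  have hB : 64 * (B.card : ℝ) ≤ n := by linarith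
  -- The + 1 in `hβ` absorbs the rounding of (1 - β)n, which can discard up to one point more than
  -- βn.
  have hHT : ∀ {v : Fin n → ℝ} {S' : Finset (Fin n)}, IsHardThreshold v ((1 - β) * n) S' →
      S'.card + B.card ≤ n ∧ 64 * (S'ᶜ.card : ℝ) ≤ n := by
    intro v S' h
    have hk0 : 0 ≤ (1 - β) * n := mul_nonneg (by linarith) hn'.le
    have hcard := h.card_eq hk0 (by nlinarith)
    have h1 := Nat.floor_le hk0
    have h2 := Nat.lt_floor_add_one ((1 - β) * n)
    rw [← hcard] at h1 h2
    constructor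
    · have : (S'.card : ℝ) + B.card ≤ n := by linarith
      exact_mod_cast this
    · have h3 : ((S'ᶜ.card : ℕ) : ℝ) = n - S'.card := by
        rw [eq_sub_iff_add_eq']
        exact_mod_cast (by simp)
      rw [h3]
      linarith
  -- The invariant of the iteration.
  have hinv : ∀ t, 64 * ((S t)ᶜ.card : ℝ) ≤ n ∧
      ((∑ i ∈ S t, b i ^ 2 ≤ (552 / 1000) ^ t * ‖b‖ ^ 2 ∧
          (t = 0 ∨ n * ‖u t‖ ^ 2 ≤ 3 / 5 * ((552 / 1000) ^ (t - 1) * ‖b‖ ^ 2))) ∨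
        √(∑ i ∈ S t, (b i - inner ℝ (u t) (g i)) ^ 2) ≤ τ) := by
    intro t
    induction t with
    | zero =>
      refine ⟨by simp [hS0], Or.inl ⟨?_, Or.inl rfl⟩⟩
      rw [hS0, pow_zero, one_mul, EuclideanSpace.real_norm_sq_eq]
    | succ t ih =>
      obtain ⟨hSt, ih⟩ := ih
      by_cases hsmall : √(∑ i ∈ S t, (b i - inner ℝ (u t) (g i)) ^ 2) ≤ τ
      · obtain ⟨h1, h2⟩ := hhalt t hsmall
        rw [h1, h2]
        exact ⟨hSt, Or.inr hsmall⟩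
      · obtain ⟨hmin, hht⟩ := hstep t (not_le.1 hsmall)
        obtain ⟨hc1, hc2⟩ := hHT hht
        refine ⟨hc2, Or.inl ?_⟩
        have ih1 := (ih.resolve_right hsmall).1
        have h1 := hg.norm_sq_le_of_isMin hn0 hSt hB hbB hmin
        have h2 := hg.sum_sq_le_of_isHardThreshold hB hbB hht hc1
        refine ⟨?_, Or.inr ?_⟩
        · rw [pow_succ]
          linarith
        · rw [Nat.add_sub_cancel]
          linarith
  obtain ⟨hST, hfin | hsmall⟩ := hinv T
  · have h1 := hfin.2.resolve_left (by omega)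
    refine le_of_sq_le_sq ?_ hε.le
    -- For b = 0 the logarithm takes the default value 0 and says nothing, but the invariant already
    -- forces u = 0.
    rcases eq_or_ne b 0 with rfl | hb0
    · have : n * ‖u T‖ ^ 2 ≤ 0 := by simpa using h1
      nlinarith [sq_nonneg ‖u T‖, sq_nonneg ε]
    have hlog : 1 / √(n : ℝ) * (‖b‖ / ε) ≤ Real.exp (T / 10) := by
      rw [← Real.log_le_iff_le_exp (by positivity)]
      linarith
    have h2 : ‖b‖ ^ 2 ≤ Real.exp (1 / 5) ^ T * (n * ε ^ 2) := by
      have h3 := pow_le_pow_left₀ (by positivity) hlog 2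
      rw [mul_pow, div_pow, div_pow, Real.sq_sqrt hn'.le, one_pow, ← Real.exp_nat_mul] at h3
      rw [← Real.exp_nat_mul, show (T : ℝ) * (1 / 5) = ((2 : ℕ) : ℝ) * (T / 10) by push_cast; ring]
      rw [div_mul_div_comm, div_le_iff₀ (by positivity)] at h3
      linarith
    have hexp : Real.exp (1 / 5) ≤ 5 / 4 := by
      refine (Real.exp_bound' (n := 3) (by norm_num) (by norm_num) (by norm_num)).trans ?_
      norm_num [Finset.sum_range_succ, Nat.factorial]
    have h3 : ‖b‖ ^ 2 ≤ (5 / 4) ^ T * (n * ε ^ 2) := h2.trans (by gcongr)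
    -- The contraction acts only T - 1 times before the last fit; the spare factor 5/4 is paid by
    -- 3/5, and 0.552 · 5/4 = 0.69.
    have h4 : 3 / 5 * ((552 / 1000) ^ (T - 1) * (5 / 4) ^ T) ≤ (1 : ℝ) := by
      obtain ⟨k, rfl⟩ : ∃ k, T = k + 1 := ⟨T - 1, by omega⟩
      rw [Nat.add_sub_cancel, pow_succ (5 / 4 : ℝ) k, ← mul_assoc ((552 / 1000 : ℝ) ^ k), ← mul_pow]
      have : (552 / 1000 * (5 / 4) : ℝ) ^ k ≤ 1 := pow_le_one₀ (by norm_num) (by norm_num)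
      linarith
    have h5 : n * ‖u T‖ ^ 2 ≤ n * ε ^ 2 := by
      calc n * ‖u T‖ ^ 2 ≤ 3 / 5 * ((552 / 1000) ^ (T - 1) * ((5 / 4) ^ T * (n * ε ^ 2))) := by
            refine h1.trans ?_
            gcongr
        _ = 3 / 5 * ((552 / 1000) ^ (T - 1) * (5 / 4) ^ T) * (n * ε ^ 2) := by ring
        _ ≤ 1 * (n * ε ^ 2) := by gcongr
        _ = n * ε ^ 2 := one_mul _
    exact le_of_mul_le_mul_left h5 hn'
  · refine (Real.le_sqrt_of_sq_le ?_).trans (hsmall.trans hτ)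
    exact hg.norm_sq_le_of_residual hn hST hB hbB (u T)

/-! ### Extreme eigenvalues and Gram matrices -/

section Spectrum

variable {p : ℕ}

theorem posSemidef_iff_dotProduct {A : Matrix (Fin p) (Fin p) ℝ} (hA : A.IsHermitian) :
    A.PosSemidef ↔ ∀ v : Fin p → ℝ, 0 ≤ v ⬝ᵥ A.mulVec v := by
  rw [Matrix.posSemidef_iff_dotProduct_mulVec, and_iff_right hA]
  simp

theorem nonempty_spectrum {A : Matrix (Fin p) (Fin p) ℝ} (hp : 1 ≤ p) (hA : A.IsHermitian) :
    (spectrum ℝ A).Nonempty :=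
  ⟨_, hA.eigenvalues_mem_spectrum_real ⟨0, hp⟩⟩

/-- The quadratic form bound is the Loewner inequality c·1 ≤ A, i.e. a spectrum above c. Positive
size keeps the spectrum nonempty, since `sInf ∅ = 0`. -/
theorem le_lambdaMin {A : Matrix (Fin p) (Fin p) ℝ} (hp : 1 ≤ p) (hA : A.IsHermitian) {c : ℝ}
    (h : ∀ v : Fin p → ℝ, c * (v ⬝ᵥ v) ≤ v ⬝ᵥ A.mulVec v) : c ≤ lambdaMin A := by
  have hle : algebraMap ℝ _ c ≤ A := by
    rw [Matrix.le_iff, posSemidef_iff_dotProduct (hA.sub (by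
      simp [Matrix.IsHermitian, Matrix.algebraMap_eq_diagonal]))]
    intro v
    have := h v
    simp only [Algebra.algebraMap_eq_smul_one, Matrix.sub_mulVec, Matrix.smul_mulVec,
      Matrix.one_mulVec, dotProduct_sub, dotProduct_smul, smul_eq_mul]
    linarith
  exact le_csInf (nonempty_spectrum hp hA)
    ((algebraMap_le_iff_le_spectrum hA.isSelfAdjoint).1 hle)

theorem lambdaMax_le {A : Matrix (Fin p) (Fin p) ℝ} (hp : 1 ≤ p) (hA : A.IsHermitian) {c : ℝ}
    (h : ∀ v : Fin p → ℝ, v ⬝ᵥ A.mulVec v ≤ c * (v ⬝ᵥ v)) : lambdaMax A ≤ c := by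
  have hle : A ≤ algebraMap ℝ _ c := by
    rw [Matrix.le_iff, posSemidef_iff_dotProduct (Matrix.IsHermitian.sub (by
      simp [Matrix.IsHermitian, Matrix.algebraMap_eq_diagonal]) hA)]
    intro v
    have := h v
    simp only [Algebra.algebraMap_eq_smul_one, Matrix.sub_mulVec, Matrix.smul_mulVec,
      Matrix.one_mulVec, dotProduct_sub, dotProduct_smul, smul_eq_mul]
    linarith
  exact csSup_le (nonempty_spectrum hp hA)
    ((le_algebraMap_iff_spectrum_le hA.isSelfAdjoint).1 hle)

theorem lambdaMin_mul_le {A : Matrix (Fin p) (Fin p) ℝ} (hA : A.IsHermitian) (v : Fin p → ℝ) :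
    lambdaMin A * (v ⬝ᵥ v) ≤ v ⬝ᵥ A.mulVec v := by
  have hle : algebraMap ℝ _ (lambdaMin A) ≤ A :=
    (algebraMap_le_iff_le_spectrum hA.isSelfAdjoint).2 fun x hx =>
      csInf_le (Matrix.finite_real_spectrum (A := A)).bddBelow hx
  have h := (Matrix.le_iff.1 hle).dotProduct_mulVec_nonneg v
  simp only [Algebra.algebraMap_eq_smul_one, Matrix.sub_mulVec, Matrix.smul_mulVec,
    Matrix.one_mulVec, dotProduct_sub, dotProduct_smul, smul_eq_mul, star_trivial] at h
  linarith

end Spectrum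

section Gram

variable {p n : ℕ} (g : Fin n → EuclideanSpace ℝ (Fin p)) (S : Finset (Fin n))

theorem isHermitian_colSubmatrix_mul_transpose (X : Matrix (Fin p) (Fin n) ℝ) :
    (colSubmatrix X S * (colSubmatrix X S).transpose).IsHermitian := by
  simp [Matrix.IsHermitian, Matrix.transpose_mul]

theorem dotProduct_gram_mulVec (v : Fin p → ℝ) :
    v ⬝ᵥ (colSubmatrix (designMatrix g) S * (colSubmatrix (designMatrix g) S).transpose).mulVec v =
      ∑ i ∈ S, inner ℝ (WithLp.toLp 2 v) (g i) ^ 2 := by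
  rw [← Matrix.mulVec_mulVec, Matrix.dotProduct_mulVec, ← Matrix.mulVec_transpose, dotProduct,
    ← Finset.sum_coe_sort S]
  refine Finset.sum_congr rfl fun i _ => ?_
  rw [← sq]
  congr 1

theorem dotProduct_self_eq_norm_sq (v : Fin p → ℝ) : v ⬝ᵥ v = ‖WithLp.toLp 2 v‖ ^ 2 := by
  rw [EuclideanSpace.real_norm_sq_eq, dotProduct]
  exact Finset.sum_congr rfl fun i _ => (sq _).symm

variable {g}

theorem FrameBounds.subsetStronglySmooth (hg : FrameBounds g) (hp : 1 ≤ p) {β : ℝ} (hβ : 0 ≤ β)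
    (hβn : 64 * (β * n) ≤ n) :
    SubsetStronglySmooth (designMatrix g) β (23 / 100 * n) := by
  intro S hS
  refine lambdaMax_le hp (isHermitian_colSubmatrix_mul_transpose S _) fun v => ?_
  rw [dotProduct_gram_mulVec, dotProduct_self_eq_norm_sq]
  refine hg.upper S (le_trans ?_ hβn) _
  have hS' : S.card = ⌊β * (n : ℝ)⌋₊ := hS
  rw [hS']
  gcongr
  exact Nat.floor_le (by positivity)

theorem FrameBounds.subsetStronglyConvex (hg : FrameBounds g) (hp : 1 ≤ p) {β : ℝ}
    (hβn : 64 * (β * n + 1) ≤ n) :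
    SubsetStronglyConvex (designMatrix g) (1 - β) (62 / 100 * n) := by
  intro S hS
  refine le_lambdaMin hp (isHermitian_colSubmatrix_mul_transpose S _) fun v => ?_
  rw [dotProduct_gram_mulVec, dotProduct_self_eq_norm_sq]
  refine hg.lower_of_compl ?_ _
  have hS' : S.card = ⌊(1 - β) * (n : ℝ)⌋₊ := hS
  have h2 := Nat.lt_floor_add_one ((1 - β) * (n : ℝ))
  rw [← hS'] at h2
  have h3 : ((Sᶜ.card : ℕ) : ℝ) = n - S.card := by
    rw [eq_sub_iff_add_eq']
    exact_mod_cast (by simp)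
  rw [h3]
  linarith

end Gram

/-! ### Whitening -/

section Whitening

variable {p : ℕ} {Sig : Matrix (Fin p) (Fin p) ℝ}

theorem inner_toEuclideanCLM_comm {A : Matrix (Fin p) (Fin p) ℝ} (hA : A.IsHermitian)
    (u v : EuclideanSpace ℝ (Fin p)) :
    inner ℝ (Matrix.toEuclideanCLM (𝕜 := ℝ) A u) v =
      inner ℝ u (Matrix.toEuclideanCLM (𝕜 := ℝ) A v) := by
  have h : IsSelfAdjoint (Matrix.toEuclideanCLM (𝕜 := ℝ) A) := hA.isSelfAdjoint.map _
  rw [← ContinuousLinearMap.adjoint_inner_right, h.adjoint_eq]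

theorem isHermitian_sqrt (A : Matrix (Fin p) (Fin p) ℝ) : (CFC.sqrt A).IsHermitian :=
  (Matrix.nonneg_iff_posSemidef.1 (CFC.sqrt_nonneg A)).1

theorem isUnit_det_sqrt (hSig : Sig.PosDef) : IsUnit (CFC.sqrt Sig).det := by
  rw [← Matrix.isUnit_iff_isUnit_det, CFC.isUnit_sqrt_iff Sig hSig.posSemidef.nonneg]
  exact hSig.isUnit

theorem toEuclideanCLM_sqrt_inv (hSig : Sig.PosDef) (v : EuclideanSpace ℝ (Fin p)) :
    Matrix.toEuclideanCLM (𝕜 := ℝ) (CFC.sqrt Sig)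
      (Matrix.toEuclideanCLM (𝕜 := ℝ) (CFC.sqrt Sig)⁻¹ v) = v := by
  rw [← mul_apply_eq_comp, ← map_mul, Matrix.mul_nonsing_inv _ (isUnit_det_sqrt hSig),
    map_one, one_apply_eq_self]

theorem toEuclideanCLM_inv_sqrt (hSig : Sig.PosDef) (v : EuclideanSpace ℝ (Fin p)) :
    Matrix.toEuclideanCLM (𝕜 := ℝ) (CFC.sqrt Sig)⁻¹
      (Matrix.toEuclideanCLM (𝕜 := ℝ) (CFC.sqrt Sig) v) = v := by
  rw [← mul_apply_eq_comp, ← map_mul, Matrix.nonsing_inv_mul _ (isUnit_det_sqrt hSig),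
    map_one, one_apply_eq_self]

/-- Σ^{1/2} is self-adjoint and cancels its inverse; this carries the residuals over to whitened
coordinates. -/
theorem inner_sqrt_whitened (hSig : Sig.PosDef) (u v : EuclideanSpace ℝ (Fin p)) :
    inner ℝ (Matrix.toEuclideanCLM (𝕜 := ℝ) (CFC.sqrt Sig) u)
      (Matrix.toEuclideanCLM (𝕜 := ℝ) (CFC.sqrt Sig)⁻¹ v) = inner ℝ u v := by
  rw [inner_toEuclideanCLM_comm (isHermitian_sqrt Sig), toEuclideanCLM_sqrt_inv hSig]

theorem mul_designMatrix {n : ℕ} (A : Matrix (Fin p) (Fin p) ℝ)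
    (x : Fin n → EuclideanSpace ℝ (Fin p)) :
    A * designMatrix x = designMatrix fun i => Matrix.toEuclideanCLM (𝕜 := ℝ) A (x i) := by
  ext j i
  simp [Matrix.mul_apply, designMatrix, Matrix.mulVec, dotProduct]

theorem sqrt_lambdaMin_mul_norm_le (hSig : Sig.PosDef) (v : EuclideanSpace ℝ (Fin p)) :
    √(lambdaMin Sig) * ‖v‖ ≤ ‖Matrix.toEuclideanCLM (𝕜 := ℝ) (CFC.sqrt Sig) v‖ := by
  have h1 : ‖Matrix.toEuclideanCLM (𝕜 := ℝ) (CFC.sqrt Sig) v‖ ^ 2 =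
      v.ofLp ⬝ᵥ Sig.mulVec v.ofLp := by
    rw [← real_inner_self_eq_norm_sq, inner_toEuclideanCLM_comm (isHermitian_sqrt Sig),
      ← mul_apply_eq_comp, ← map_mul,
      CFC.sqrt_mul_sqrt_self Sig hSig.posSemidef.nonneg, Matrix.inner_toEuclideanCLM]
  have h2 := lambdaMin_mul_le hSig.1 v.ofLp
  rw [← h1, dotProduct_self_eq_norm_sq] at h2
  rw [← abs_of_nonneg (norm_nonneg (Matrix.toEuclideanCLM (𝕜 := ℝ) (CFC.sqrt Sig) v)),
    ← Real.sqrt_sq (norm_nonneg v), ← Real.sqrt_sq_eq_abs, ← Real.sqrt_mul' _ (sq_nonneg _)]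
  exact Real.sqrt_le_sqrt h2

/-- N(0, Σ) is the image of the standard Gaussian under Σ^{1/2}, which whitening undoes; a unit
functional of the standard Gaussian has mean 0 and variance 1. -/
theorem hasLaw_inner_whitened (hSig : Sig.PosDef) {u : EuclideanSpace ℝ (Fin p)} (hu : ‖u‖ = 1) :
    HasLaw (fun v => inner ℝ u (Matrix.toEuclideanCLM (𝕜 := ℝ) (CFC.sqrt Sig)⁻¹ v))
      (gaussianReal 0 1) (multivariateGaussian 0 Sig) := by
  refine ⟨by fun_prop, ?_⟩
  rw [multivariateGaussian, Measure.map_map (by fun_prop) (by fun_prop)]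
  have h : (fun v => (inner ℝ u (Matrix.toEuclideanCLM (𝕜 := ℝ) (CFC.sqrt Sig)⁻¹ v) : ℝ)) ∘
      (fun v => 0 + Matrix.toEuclideanCLM (𝕜 := ℝ) (CFC.sqrt Sig) v) =
      (innerSL ℝ u : StrongDual ℝ (EuclideanSpace ℝ (Fin p))) := by
    ext v
    simp [toEuclideanCLM_inv_sqrt hSig]
  rw [h, IsGaussian.map_eq_gaussianReal, integral_strongDual_stdGaussian, variance_dual_stdGaussian,
    innerSL_apply_norm, hu]
  simp

end Whitening

/-! ### Probability of the frame bounds -/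

/-- With high probability the frame bounds hold for points whose one-dimensional projections are
independent standard Gaussians. -/
theorem measure_not_frameBounds_le {Ω : Type*} [MeasurableSpace Ω] {P : Measure Ω} {p n : ℕ}
    {g : Fin n → Ω → EuclideanSpace ℝ (Fin p)}
    (hlaw : ∀ u : EuclideanSpace ℝ (Fin p), ‖u‖ = 1 →
      ∀ i, HasLaw (fun ω => inner ℝ u (g i ω)) (gaussianReal 0 1) P)
    (hind : ∀ u : EuclideanSpace ℝ (Fin p), iIndepFun (fun i ω => (inner ℝ u (g i ω) : ℝ)) P) :
    P {ω | ¬ FrameBounds fun i => g i ω} ≤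
      ENNReal.ofReal (2 * 2001 ^ p * Real.exp (-(n / 500))) := by
  obtain ⟨N, hN1, hN, hcard⟩ := exists_sphere_net (EuclideanSpace ℝ (Fin p))
    (ε := 1 / 1000) (by norm_num)
  have hcard' : (N.card : ℝ) ≤ 2001 ^ p := by
    rw [finrank_euclideanSpace_fin] at hcard
    convert! hcard using 2
    norm_num
  let A (v : EuclideanSpace ℝ (Fin p)) : Set Ω :=
    {ω | 1 / 25 * (n : ℝ) ≤ ∑ i, max ((inner ℝ v (g i ω) : ℝ) ^ 2 - 12) 0}
  let A' (v : EuclideanSpace ℝ (Fin p)) : Set Ω :=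
    {ω | ∑ i, (inner ℝ v (g i ω) : ℝ) ^ 2 ≤ 22 / 25 * (n : ℝ)}
  have hsub : {ω | ¬ FrameBounds fun i => g i ω} ⊆ ⋃ v ∈ N, (A v ∪ A' v) := by
    intro ω hω
    by_contra hcon
    simp only [Set.mem_iUnion, not_exists, Set.mem_union, not_or] at hcon
    exact hω (FrameBounds.of_net (N := N) hN
      (fun v hv => (not_le.1 (hcon v hv).1).le) fun v hv => (not_le.1 (hcon v hv).2).le)
  calc P {ω | ¬ FrameBounds fun i => g i ω} ≤ P (⋃ v ∈ N, (A v ∪ A' v)) := measure_mono hsub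
    _ ≤ ∑ v ∈ N, P (A v ∪ A' v) := measure_biUnion_finset_le _ _
    _ ≤ ∑ _v ∈ N, ENNReal.ofReal (2 * Real.exp (-(n / 500))) := by
        refine Finset.sum_le_sum fun v hv => (measure_union_le _ _).trans ?_
        rw [two_mul, ENNReal.ofReal_add (Real.exp_pos _).le (Real.exp_pos _).le]
        exact add_le_add
          (measure_sum_truncated_sq_ge_le (hlaw v (hN1 v hv)) (hind v))
          (measure_sum_sq_le_le (hlaw v (hN1 v hv)) (hind v))
    _ = ENNReal.ofReal (N.card * (2 * Real.exp (-(n / 500)))) := by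
        rw [Finset.sum_const, nsmul_eq_mul, ENNReal.ofReal_mul (Nat.cast_nonneg _),
          ENNReal.ofReal_natCast]
    _ ≤ ENNReal.ofReal (2 * 2001 ^ p * Real.exp (-(n / 500))) := by
        refine ENNReal.ofReal_le_ofReal ?_
        calc N.card * (2 * Real.exp (-(n / 500 : ℝ)))
            ≤ 2001 ^ p * (2 * Real.exp (-(n / 500 : ℝ))) := by gcongr
          _ = _ := by ring

theorem failure_bound_le {p n : ℕ} {δ : ℝ} (hp : 1 ≤ p) (hδ : 0 < δ) (hδ1 : δ ≤ 1)
    (hn : 4500 * ((p : ℝ) + Real.log (1 / δ)) ≤ n) :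
    2 * 2001 ^ p * Real.exp (-(n / 500)) ≤ δ := by
  have he : (2.7 : ℝ) ≤ Real.exp 1 := by linarith [Real.exp_one_gt_d9]
  have h2 : (2 : ℝ) ≤ Real.exp 1 := by linarith
  have h8 : (2001 : ℝ) ≤ Real.exp 8 := by
    rw [show (8 : ℝ) = (8 : ℕ) * 1 by norm_num, Real.exp_nat_mul]
    exact le_trans (by norm_num) (pow_le_pow_left₀ (by norm_num) he 8)
  have hlog : Real.log δ ≤ 0 := Real.log_nonpos hδ.le hδ1
  have hp' : (1 : ℝ) ≤ p := by exact_mod_cast hp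
  rw [one_div, Real.log_inv] at hn
  -- Since 2 ≤ e and 2001 ≤ e^8, it is enough that n/500 ≥ 1 + 8p + log(1/δ); 4500 = 9 · 500 gives
  -- this as p ≥ 1.
  calc 2 * 2001 ^ p * Real.exp (-(n / 500))
      ≤ Real.exp 1 * Real.exp 8 ^ p * Real.exp (-(n / 500)) := by gcongr
    _ = Real.exp (1 + p * 8 + -(n / 500)) := by
        rw [← Real.exp_nat_mul, ← Real.exp_add, ← Real.exp_add]
    _ ≤ Real.exp (Real.log δ) := Real.exp_le_exp.2 (by linarith)
    _ = δ := Real.exp_log hδ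

/-- The bad set need not be measurable; the complement of its measurable hull serves as the event.
-/
theorem exists_measurableSet_forall {Ω : Type*} [MeasurableSpace Ω] (P : Measure Ω)
    [IsProbabilityMeasure P] {q : Ω → Prop} {δ : ℝ} (hδ : 0 ≤ δ)
    (h : P {ω | ¬ q ω} ≤ ENNReal.ofReal δ) :
    ∃ E : Set Ω, MeasurableSet E ∧ 1 - δ ≤ P.real E ∧ ∀ ω ∈ E, q ω := by
  refine ⟨(toMeasurable P {ω | ¬ q ω})ᶜ, (measurableSet_toMeasurable _ _).compl, ?_,
    fun ω hω => ?_⟩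
  · rw [probReal_compl_eq_one_sub (measurableSet_toMeasurable _ _), measureReal_def,
      measure_toMeasurable]
    linarith [ENNReal.toReal_le_of_le_ofReal hδ h]
  · by_contra hq
    exact hω (subset_toMeasurable P _ hq)

/-! ### Transfer to the original data and conclusion -/

/-- On whitened data satisfying the frame bounds, every run of TORRENT-FC converges. -/
theorem FrameBounds.norm_sqrt_sub_le {p n : ℕ} {Sig : Matrix (Fin p) (Fin p) ℝ}
    (hSig : Sig.PosDef) {x : Fin n → EuclideanSpace ℝ (Fin p)}
    (hg : FrameBounds fun i => Matrix.toEuclideanCLM (𝕜 := ℝ) (CFC.sqrt Sig)⁻¹ (x i))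
    (hn : 3 ≤ n) {β : ℝ} (hβ1 : β ≤ 1) (hβ : 64 * (β * n + 1) ≤ n)
    {wstar : EuclideanSpace ℝ (Fin p)} {b y : EuclideanSpace ℝ (Fin n)}
    (hb : ((Finset.univ.filter fun i => b i ≠ 0).card : ℝ) ≤ β * n)
    (hy : ∀ i, y i = inner ℝ wstar (x i) + b i) {ε τ : ℝ} (hε : 0 < ε) (hτ : τ ≤ ε)
    {w : ℕ → EuclideanSpace ℝ (Fin p)} {S : ℕ → Finset (Fin n)} (hrun : IsRunFC x y β τ w S)
    {T : ℕ} (hT : 1 ≤ T) (hTlog : 10 * Real.log (1 / √(n : ℝ) * (‖b‖ / ε)) ≤ T) :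
    ‖Matrix.toEuclideanCLM (𝕜 := ℝ) (CFC.sqrt Sig) (w T - wstar)‖ ≤ ε := by
  have hres (v : EuclideanSpace ℝ (Fin p)) : residual x y v = fun i =>
      b i - inner ℝ (Matrix.toEuclideanCLM (𝕜 := ℝ) (CFC.sqrt Sig) (v - wstar))
        (Matrix.toEuclideanCLM (𝕜 := ℝ) (CFC.sqrt Sig)⁻¹ (x i)) := by
    funext i
    rw [inner_sqrt_whitened hSig, residual, hy, inner_sub_left]
    ring
  refine hg.norm_le_of_run (u := fun t => Matrix.toEuclideanCLM (𝕜 := ℝ) (CFC.sqrt Sig)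
    (w t - wstar)) (S := S) hn hβ1 hβ hb hε hτ hrun.S_zero (fun t ht => ?_) (fun t ht => ?_) hT
    hTlog
  · obtain ⟨hmin, hht⟩ := hrun.step t (by simpa only [sqError, hres] using ht)
    refine ⟨fun v => ?_, by simpa only [hres] using hht⟩
    -- Every whitened competitor v comes from the original competitor Σ^{-1/2}v + w*.
    have h := hmin (Matrix.toEuclideanCLM (𝕜 := ℝ) (CFC.sqrt Sig)⁻¹ v + wstar)
    simpa only [sqError, hres, add_sub_cancel_right, toEuclideanCLM_sqrt_inv hSig] using h
  · obtain ⟨hw, hS⟩ := hrun.halt t (by simpa only [sqError, hres] using ht)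
    exact ⟨by rw [hw], hS⟩

end Torrent

theorem theorem2 :
    ∃ C : ℝ, 0 < C ∧
      ∀ {Ω : Type*} [MeasurableSpace Ω] (P : Measure Ω) [IsProbabilityMeasure P]
        (p n : ℕ) (Sig : Matrix (Fin p) (Fin p) ℝ)
        (x : Fin n → Ω → EuclideanSpace ℝ (Fin p)) (α β δ : ℝ),
        1 ≤ p → Sig.PosDef →
        (∀ i, HasLaw (x i) (multivariateGaussian 0 Sig) P) → iIndepFun x P →
        0 ≤ α → α ≤ β → β < 1 / 65 → 0 < δ → δ < 1 →
        C * ((p : ℝ) + Real.log (1 / δ)) ≤ (n : ℝ) →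
        ∃ E : Set Ω, MeasurableSet E ∧ 1 - δ ≤ P.real E ∧ ∀ ω ∈ E,
          -- the SSC and SSS constants of the whitened data matrix
          (∃ Lam lam : ℝ,
            Torrent.SubsetStronglySmooth
              ((CFC.sqrt Sig)⁻¹ * Torrent.designMatrix fun i => x i ω) β Lam ∧
            Torrent.SubsetStronglyConvex
              ((CFC.sqrt Sig)⁻¹ * Torrent.designMatrix fun i => x i ω) (1 - β) lam ∧
            0 < lam ∧ (1 + √2) * Lam / lam < 9 / 10) ∧
          -- convergence, for every model and every corruption (both may depend on the data)
          ∀ (wstar : EuclideanSpace ℝ (Fin p)) (b y : EuclideanSpace ℝ (Fin n)),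
            ((Finset.univ.filter fun i => b i ≠ 0).card : ℝ) ≤ α * (n : ℝ) →
            (∀ i, y i = inner ℝ wstar (x i ω) + b i) →
            ∀ (ε τ : ℝ), 0 < ε → τ ≤ ε →
            ∀ (w : ℕ → EuclideanSpace ℝ (Fin p)) (S : ℕ → Finset (Fin n)),
              Torrent.IsRunFC (fun i => x i ω) y β τ w S →
              ∀ T : ℕ, 1 ≤ T → 10 * Real.log (1 / √(n : ℝ) * (‖b‖ / ε)) ≤ (T : ℝ) →
                ‖Matrix.toEuclideanCLM (𝕜 := ℝ) (CFC.sqrt Sig) (w T - wstar)‖ ≤ ε ∧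
                √(Torrent.lambdaMin Sig) * ‖w T - wstar‖ ≤ ε := by
  refine ⟨4500, by norm_num, ?_⟩
  intro Ω _ P _ p n Sig x α β δ hp hSig hlaw hind hα hαβ hβ hδ hδ1 hn
  have hn' : (4500 : ℝ) ≤ n := by
    have h1 : (1 : ℝ) ≤ p := by exact_mod_cast hp
    have h2 : 0 ≤ Real.log (1 / δ) := Real.log_nonneg (by
      rw [le_div_iff₀ hδ]
      linarith)
    linarith
  have hβ0 : 0 ≤ β := hα.trans hαβ
  -- The gap between 1/65 and 1/64 pays for the rounding: n - 64n/65 = n/65 ≥ 64.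
  have hβn : 64 * (β * n + 1) ≤ (n : ℝ) := by
    have : β * n ≤ 1 / 65 * n := by gcongr
    linarith
  have hprob : P {ω | ¬ Torrent.FrameBounds fun i =>
      Matrix.toEuclideanCLM (𝕜 := ℝ) (CFC.sqrt Sig)⁻¹ (x i ω)} ≤ ENNReal.ofReal δ :=
    (Torrent.measure_not_frameBounds_le
      (fun u hu i => (Torrent.hasLaw_inner_whitened hSig hu).fun_comp (hlaw i))
      fun u => hind.comp
        (fun _ v => inner ℝ u (Matrix.toEuclideanCLM (𝕜 := ℝ) (CFC.sqrt Sig)⁻¹ v))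
        fun _ => by fun_prop).trans
      (ENNReal.ofReal_le_ofReal (Torrent.failure_bound_le hp hδ hδ1.le hn))
  obtain ⟨E, hE, hPE, hgood⟩ := Torrent.exists_measurableSet_forall P hδ.le hprob
  refine ⟨E, hE, hPE, fun ω hω => ?_⟩
  have hg := hgood ω hω
  refine ⟨⟨23 / 100 * n, 62 / 100 * n, ?_, ?_, by linarith, ?_⟩, ?_⟩
  · rw [Torrent.mul_designMatrix]
    exact hg.subsetStronglySmooth hp hβ0 (by linarith)
  · rw [Torrent.mul_designMatrix]
    exact hg.subsetStronglyConvex hp hβn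
  · have h2 : √2 ≤ (142 / 100 : ℝ) := Real.sqrt_le_iff.2 (by norm_num)
    rw [div_lt_iff₀ (by linarith)]
    nlinarith
  · intro wstar b y hb hy ε τ hε hτ w S hrun T hT hTlog
    have hfin : ‖Matrix.toEuclideanCLM (𝕜 := ℝ) (CFC.sqrt Sig) (w T - wstar)‖ ≤ ε :=
      hg.norm_sqrt_sub_le hSig (by exact_mod_cast (by linarith : (3 : ℝ) ≤ n)) (by linarith) hβn
        (hb.trans (by gcongr)) hy hε hτ hrun hT hTlog
    exact ⟨hfin, (Torrent.sqrt_lambdaMin_mul_norm_le hSig _).trans hfin⟩
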